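/- Let $r\ge 1$ and let $P_1,\dots,P_r,W_1,\dots,W_r\in\mathbb{C}[z]$ be non-constant polynomials such that $$P_1\circ W_1=P_2\circ W_2=\dots=P_r\circ W_r,$$ where $\circ$ denotes composition, $(P\circ W)(z)=P(W(z))$. Then there exist polynomials $U,V\in\mathbb{C}[z]$ and $\widetilde P_i,\widetilde W_i\in\mathbb{C}[z]$, $1\le i\le r$, with $$\deg U=\gcd(\deg P_1,\dots,\deg P_r),\qquad \deg V=\gcd(\deg W_1,\dots,\deg W_r),$$ such that $$P_i=U\circ\widetilde P_i,\qquad W_i=\widetilde W_i\circ V,\qquad 1\le i\le r,$$ and $$\widetilde P_1\circ\widetilde W_1=\widetilde P_2\circ\widetilde W_2=\dots=\widetilde P_r\circ\widetilde W_r.$$ -/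

import Mathlib

/-!
The proof works at infinity, in the field of Laurent series in `1 / z`. If `F` has degree `N`, then
by Hensel's lemma the equation `F(y) = F(z)` has there exactly one solution `y ζ` with leading term
`ζ z` for each `N`-th root of unity `ζ` (`exists_isBranchSystem`). If `F = P ∘ W`, the solutions of
`W(y) = W(z)` are the `y ζ` with `ζ ^ deg W = 1`, and more generally `W(y ζ)` depends only on
`ζ ^ deg W` (`IsBranchSystem.aeval_eq_of_pow_eq`). A composition factor is thereby governed by its
degree, and a polynomial `D` of degree `d` fixed by `z ↦ y ζ` for `ζ ^ d = 1` generates all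
polynomials so fixed (`exists_eq_comp_of_aeval_branch_eq`).

Let `P₁ ∘ W₁ = P₂ ∘ W₂`. For a common right factor of degree `g = gcd (deg W₁) (deg W₂)` one takes
the product of the `-y η` with `η ^ g = 1`. It is a polynomial in `z`, because it is the constant
coefficient of the greatest common divisor of `W₁(X) - W₁(z)` and `W₂(X) - W₂(z)`, which lies in
`ℂ[z][X]` by Gauss's lemma (`exists_common_right_factor`). For the left factor one needs an element
of degree `lcm (deg W₁) (deg W₂)` in `ℂ[W₁] ∩ ℂ[W₂]`, which is found as a trace
(`exists_comp_eq_natDegree_lcm`); it generates this intersection, hence `P₁ ∘ W₁` is a polynomial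
in it, and that polynomial is the left factor (`exists_common_left_factor`). Induction extends both
statements to any number of decompositions.
-/

open Polynomial

/-! ### Leading terms of Laurent series at infinity -/

/-- The coordinate `z` of the affine line in the field of Laurent series at infinity, whose
uniformizer is `1 / z`. -/
noncomputable def zInf : LaurentSeries ℂ := HahnSeries.single (-1) 1

lemma zInf_mul_X : zInf * HahnSeries.ofPowerSeries ℤ ℂ PowerSeries.X = 1 := by
  simp [zInf]

lemma zInf_ne_zero : zInf ≠ 0 := left_ne_zero_of_mul_eq_one zInf_mul_X

lemma zInf_pow_mul_X_pow (m : ℕ) :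
    zInf ^ m * HahnSeries.ofPowerSeries ℤ ℂ (PowerSeries.X ^ m) = 1 := by
  rw [map_pow, ← mul_pow, zInf_mul_X, one_pow]

/-- `HasLead a m c` says that `a = c z ^ m + (terms of lower degree in z)`. The coefficient `c` may
vanish, so that in general `m` only bounds the degree of `a` from above. -/
def HasLead (a : LaurentSeries ℂ) (m : ℕ) (c : ℂ) : Prop :=
  ∃ α : PowerSeries ℂ, PowerSeries.constantCoeff α = c ∧
    a = zInf ^ m * HahnSeries.ofPowerSeries ℤ ℂ α

lemma hasLead_zInf : HasLead zInf 1 1 := ⟨1, by simp⟩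

lemma HasLead.mul {a b : LaurentSeries ℂ} {m n : ℕ} {c d : ℂ} (ha : HasLead a m c)
    (hb : HasLead b n d) : HasLead (a * b) (m + n) (c * d) := by
  obtain ⟨α, rfl, rfl⟩ := ha
  obtain ⟨β, rfl, rfl⟩ := hb
  exact ⟨α * β, by simp, by rw [map_mul]; ring⟩

lemma HasLead.neg {a : LaurentSeries ℂ} {m : ℕ} {c : ℂ} (ha : HasLead a m c) :
    HasLead (-a) m (-c) := by
  obtain ⟨α, rfl, rfl⟩ := ha
  exact ⟨-α, by simp, by rw [map_neg]; ring⟩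

lemma HasLead.sum {ι : Type*} (s : Finset ι) {a : ι → LaurentSeries ℂ} {m : ℕ} {c : ι → ℂ}
    (h : ∀ i ∈ s, HasLead (a i) m (c i)) : HasLead (∑ i ∈ s, a i) m (∑ i ∈ s, c i) := by
  classical
  induction s using Finset.induction_on with
  | empty => exact ⟨0, by simp⟩
  | insert i s hi ih =>
    obtain ⟨α, hα, hα'⟩ := h i (Finset.mem_insert_self i s)
    obtain ⟨β, hβ, hβ'⟩ := ih fun j hj => h j (Finset.mem_insert_of_mem hj)
    refine ⟨α + β, ?_, ?_⟩
    · rw [Finset.sum_insert hi, map_add, hα, hβ]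
    · rw [Finset.sum_insert hi, map_add, hα', hβ', mul_add]

lemma HasLead.prod {ι : Type*} (s : Finset ι) {a : ι → LaurentSeries ℂ} {c : ι → ℂ}
    (h : ∀ i ∈ s, HasLead (a i) 1 (c i)) : HasLead (∏ i ∈ s, a i) s.card (∏ i ∈ s, c i) := by
  classical
  induction s using Finset.induction_on with
  | empty => exact ⟨1, by simp⟩
  | insert i s hi ih =>
    rw [Finset.prod_insert hi, Finset.prod_insert hi, Finset.card_insert_of_notMem hi, add_comm]
    exact (h i (Finset.mem_insert_self i s)).mul
      (ih fun j hj => h j (Finset.mem_insert_of_mem hj))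

lemma HasLead.eq_of_ne_zero {a : LaurentSeries ℂ} {m n : ℕ} {c d : ℂ} (ha : HasLead a m c)
    (hb : HasLead a n d) (hc : c ≠ 0) (hd : d ≠ 0) : m = n ∧ c = d := by
  wlog hmn : m ≤ n generalizing m n c d
  · obtain ⟨h1, h2⟩ := this hb ha hd hc (by omega)
    exact ⟨h1.symm, h2.symm⟩
  obtain ⟨α, rfl, rfl⟩ := ha
  obtain ⟨β, rfl, h⟩ := hb
  obtain ⟨k, rfl⟩ := Nat.exists_eq_add_of_le hmn
  have h1 : HahnSeries.ofPowerSeries ℤ ℂ (PowerSeries.X ^ k * α) =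
      HahnSeries.ofPowerSeries ℤ ℂ β := by
    rw [pow_add, mul_assoc] at h
    rw [map_mul, mul_left_cancel₀ (pow_ne_zero m zInf_ne_zero) h, ← mul_assoc,
      mul_comm (HahnSeries.ofPowerSeries ℤ ℂ _), zInf_pow_mul_X_pow, one_mul]
  have h2 := HahnSeries.ofPowerSeries_injective h1
  rcases Nat.eq_zero_or_pos k with rfl | hk
  · simp at h2
    simp [h2]
  · rw [← h2] at hd
    simp [hk.ne'] at hd

lemma HasLead.congr_lead {a : LaurentSeries ℂ} {m : ℕ} {c d : ℂ} (ha : HasLead a m c)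
    (hb : HasLead a m d) : c = d := by
  obtain ⟨α, rfl, rfl⟩ := ha
  obtain ⟨β, rfl, h⟩ := hb
  rw [HahnSeries.ofPowerSeries_injective (mul_left_cancel₀ (pow_ne_zero m zInf_ne_zero) h)]

/-- The polynomial `u ^ (m * deg P) * P (X / u ^ m)` over the power series in the uniformizer
`u = 1 / z`. Its reduction modulo `u` is the leading monomial of `P`. -/
noncomputable def homog (P : ℂ[X]) (m : ℕ) : (PowerSeries ℂ)[X] :=
  (P.map (algebraMap ℂ (PowerSeries ℂ))).scaleRoots (PowerSeries.X ^ m)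

lemma aeval_eq_homog (P : ℂ[X]) (m : ℕ) (α : PowerSeries ℂ) :
    aeval (zInf ^ m * HahnSeries.ofPowerSeries ℤ ℂ α) P =
      zInf ^ (m * P.natDegree) * HahnSeries.ofPowerSeries ℤ ℂ ((homog P m).eval α) := by
  have h := scaleRoots_eval₂_mul (p := P.map (algebraMap ℂ (PowerSeries ℂ)))
    (HahnSeries.ofPowerSeries ℤ ℂ) (zInf ^ m * HahnSeries.ofPowerSeries ℤ ℂ α)
    (PowerSeries.X ^ m)
  rw [← mul_assoc, mul_comm _ (zInf ^ m), zInf_pow_mul_X_pow, one_mul, eval₂_at_apply] at h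
  rw [homog, h, natDegree_map, pow_mul, ← mul_assoc, ← mul_pow, zInf_pow_mul_X_pow, one_pow,
    one_mul, eval₂_map, aeval_def]
  congr 1

lemma homog_map_constantCoeff (P : ℂ[X]) {m : ℕ} (hm : 0 < m) :
    (homog P m).map PowerSeries.constantCoeff = C P.leadingCoeff * X ^ P.natDegree := by
  rcases eq_or_ne P 0 with rfl | hP
  · simp [homog]
  have hid : (PowerSeries.constantCoeff (R := ℂ)).comp (algebraMap ℂ (PowerSeries ℂ)) =
      RingHom.id ℂ := by ext; simp
  rw [homog, map_scaleRoots, Polynomial.map_map, hid, Polynomial.map_id, map_pow,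
    PowerSeries.constantCoeff_X, zero_pow hm.ne', scaleRoots_zero, smul_eq_C_mul]
  rw [leadingCoeff_map, ← RingHom.comp_apply, hid]
  simpa using hP

lemma constantCoeff_eval_homog (P : ℂ[X]) {m : ℕ} (hm : 0 < m) (α : PowerSeries ℂ) :
    PowerSeries.constantCoeff ((homog P m).eval α) =
      P.leadingCoeff * PowerSeries.constantCoeff α ^ P.natDegree := by
  rw [← eval_map_apply, homog_map_constantCoeff P hm]
  simp

lemma constantCoeff_eval_derivative_homog (P : ℂ[X]) {m : ℕ} (hm : 0 < m) (α : PowerSeries ℂ) :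
    PowerSeries.constantCoeff ((homog P m).derivative.eval α) =
      P.leadingCoeff * (P.natDegree * PowerSeries.constantCoeff α ^ (P.natDegree - 1)) := by
  rw [← eval_map_apply, ← derivative_map, homog_map_constantCoeff P hm, derivative_C_mul,
    derivative_X_pow]
  simp

lemma HasLead.aeval {a : LaurentSeries ℂ} {m : ℕ} {c : ℂ} (ha : HasLead a m c) (hm : 0 < m)
    (P : ℂ[X]) : HasLead (aeval a P) (m * P.natDegree) (P.leadingCoeff * c ^ P.natDegree) := by
  obtain ⟨α, rfl, rfl⟩ := ha
  exact ⟨_, constantCoeff_eval_homog P hm α, aeval_eq_homog P m α⟩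

/-- Uniqueness in Hensel's lemma: after rescaling, `a` and `b` are power series with the same
residue at which `homog P m` takes the same value, and the derivative at the residue is a unit. -/
lemma HasLead.eq_of_aeval_eq {a b : LaurentSeries ℂ} {m : ℕ} {c : ℂ} (ha : HasLead a m c)
    (hb : HasLead b m c) (hm : 0 < m) (hc : c ≠ 0) {P : ℂ[X]} (hP : 0 < P.natDegree)
    (h : Polynomial.aeval a P = Polynomial.aeval b P) : a = b := by
  obtain ⟨α, rfl, rfl⟩ := ha
  obtain ⟨β, hβ, rfl⟩ := hb
  rw [aeval_eq_homog, aeval_eq_homog] at h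
  have h1 := HahnSeries.ofPowerSeries_injective
    (mul_left_cancel₀ (pow_ne_zero _ zInf_ne_zero) h)
  obtain ⟨k, hk⟩ := (homog P m).binomExpansion α (β - α)
  rw [add_sub_cancel, h1] at hk
  have h2 : (β - α) * ((homog P m).derivative.eval α + k * (β - α)) = 0 := by
    linear_combination -hk
  rcases mul_eq_zero.mp h2 with h3 | h3
  · rw [sub_eq_zero.mp h3]
  · apply_fun PowerSeries.constantCoeff at h3
    rw [map_add, map_mul, map_sub, hβ, sub_self, mul_zero, add_zero,
      constantCoeff_eval_derivative_homog P hm, map_zero] at h3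
    have : P ≠ 0 := by rintro rfl; simp at hP
    simp [this, hP.ne', hc] at h3

/-- Existence by Hensel's lemma, as `ζ` is a simple root of the reduction `X ^ N - 1` of the
normalized equation. -/
lemma exists_branch {F : ℂ[X]} (hF : 0 < F.natDegree) {ζ : ℂ} (hζ : ζ ^ F.natDegree = 1) :
    ∃ y, HasLead y 1 ζ ∧ aeval y F = aeval zInf F := by
  have hF0 : F ≠ 0 := by rintro rfl; simp at hF
  have hl : F.leadingCoeff ≠ 0 := by simpa using hF0
  have hζ0 : ζ ≠ 0 := by rintro rfl; simp [hF.ne'] at hζ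
  set c : PowerSeries ℂ := algebraMap ℂ (PowerSeries ℂ) F.leadingCoeff⁻¹
  set f : (PowerSeries ℂ)[X] := C c * homog F 1 - C (c * (homog F 1).eval 1)
  have hcc : c * algebraMap ℂ (PowerSeries ℂ) F.leadingCoeff = 1 := by
    rw [← map_mul, inv_mul_cancel₀ hl, map_one]
  have hdeg : (C c * homog F 1).natDegree = F.natDegree := by
    rw [natDegree_C_mul_of_isUnit (IsUnit.of_mul_eq_one _ hcc)]
    simp [homog]
  have hmon : (C c * homog F 1).Monic := by
    rw [Monic, leadingCoeff, hdeg, coeff_C_mul, ← hcc]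
    congr 1
    have := leadingCoeff_scaleRoots (F.map (algebraMap ℂ (PowerSeries ℂ))) (PowerSeries.X ^ 1)
    rw [leadingCoeff, natDegree_scaleRoots, natDegree_map, leadingCoeff_map] at this
    exact this
  have hfmon : f.Monic := hmon.sub_of_left (by
    refine lt_of_le_of_lt degree_C_le ?_
    rw [← natDegree_pos_iff_degree_pos, hdeg]; exact hF)
  have hmem : ∀ g : PowerSeries ℂ, g ∈ Ideal.span {(PowerSeries.X : PowerSeries ℂ)} ↔
      PowerSeries.constantCoeff g = 0 := fun g => by
    rw [Ideal.mem_span_singleton, PowerSeries.X_dvd_iff]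
  obtain ⟨α, hα, hα'⟩ := HenselianRing.is_henselian
    (I := Ideal.span {(PowerSeries.X : PowerSeries ℂ)}) f hfmon
    (algebraMap ℂ (PowerSeries ℂ) ζ) (by
      rw [hmem]
      simp [f, constantCoeff_eval_homog, hζ]) (by
      refine IsUnit.map _ ?_
      rw [PowerSeries.isUnit_iff_constantCoeff]
      simp [f, c, constantCoeff_eval_derivative_homog, PowerSeries.algebraMap_apply, hF0, hζ0,
        hF.ne'])
  refine ⟨zInf ^ 1 * HahnSeries.ofPowerSeries ℤ ℂ α, ⟨α, ?_, rfl⟩, ?_⟩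
  · rw [hmem] at hα'
    simpa [PowerSeries.algebraMap_apply, sub_eq_zero] using hα'
  · have h1 : (homog F 1).eval α = (homog F 1).eval 1 := by
      have : c * (homog F 1).eval α = c * (homog F 1).eval 1 := by
        simpa [f, sub_eq_zero] using hα
      exact (IsUnit.of_mul_eq_one _ hcc).mul_left_cancel this
    have h2 := aeval_eq_homog F 1 1
    rw [map_one, mul_one, pow_one] at h2
    rw [aeval_eq_homog, h1, h2]

/-! ### Branches at infinity -/

lemma eq_C_leadingCoeff_mul_prod_X_sub_C {K ι : Type*} [Field K] {s : Finset ι} {u : ι → K}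
    (hu : Set.InjOn u s) {f : K[X]} (hf : f ≠ 0) (hroot : ∀ i ∈ s, f.IsRoot (u i))
    (hcard : f.natDegree ≤ s.card) : f = C f.leadingCoeff * ∏ i ∈ s, (X - C (u i)) := by
  have hdvd : ∏ i ∈ s, (X - C (u i)) ∣ f := by
    refine Finset.prod_dvd_of_coprime (fun a ha b hb hab => ?_) fun i hi =>
      dvd_iff_isRoot.mpr (hroot i hi)
    exact isCoprime_X_sub_C_of_isUnit_sub
      (sub_ne_zero.mpr fun he => hab (hu ha hb he)).isUnit
  have h := eq_of_monic_of_dvd_of_natDegree_le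
    (monic_prod_of_monic s _ fun i _ => monic_X_sub_C (u i)) (monic_mul_leadingCoeff_inv hf)
    (hdvd.mul_right _) (by
      rw [natDegree_prod_of_monic _ _ fun i _ => monic_X_sub_C _]
      simp only [natDegree_X_sub_C, Finset.sum_const, smul_eq_mul, mul_one]
      exact (natDegree_mul_C_le _ _).trans hcard)
  rw [← h, mul_comm, mul_assoc, ← C_mul, inv_mul_cancel₀ (leadingCoeff_ne_zero.mpr hf), C_1,
    mul_one]

/-- The solutions in Laurent series at infinity of `F(y) = F(z)`: for each root of unity `ζ` of
order dividing `deg F`, the solution `y ζ` with leading term `ζ z`. The values of `y` at other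
complex numbers are irrelevant. -/
structure IsBranchSystem (F : ℂ[X]) (y : ℂ → LaurentSeries ℂ) : Prop where
  hasLead : ∀ ζ, ζ ^ F.natDegree = 1 → HasLead (y ζ) 1 ζ
  aeval_eq : ∀ ζ, ζ ^ F.natDegree = 1 → aeval (y ζ) F = aeval zInf F

lemma exists_isBranchSystem {F : ℂ[X]} (hF : 0 < F.natDegree) : ∃ y, IsBranchSystem F y := by
  classical
  choose y hy using fun (ζ : ℂ) (hζ : ζ ^ F.natDegree = 1) => exists_branch hF hζ
  refine ⟨fun ζ => if h : ζ ^ F.natDegree = 1 then y ζ h else 0, ⟨fun ζ hζ => ?_, fun ζ hζ => ?_⟩⟩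
  · rw [dif_pos hζ]; exact (hy ζ hζ).1
  · rw [dif_pos hζ]; exact (hy ζ hζ).2

lemma HasLead.aeval_injective {a : LaurentSeries ℂ} {m : ℕ} {c : ℂ} (ha : HasLead a m c)
    (hm : 0 < m) (hc : c ≠ 0) : Function.Injective (Polynomial.aeval (R := ℂ) a) := by
  rw [injective_iff_map_eq_zero]
  intro P hP
  by_contra h0
  have h1 := ha.aeval hm P
  rw [hP] at h1
  have h2 : HasLead (0 : LaurentSeries ℂ) (m * P.natDegree) 0 := ⟨0, by simp⟩
  have := h1.congr_lead h2
  simp [h0, hc] at this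

namespace IsBranchSystem

variable {F P W : ℂ[X]} {y : ℂ → LaurentSeries ℂ}

lemma one_eq (hy : IsBranchSystem F y) (hF : 0 < F.natDegree) : y 1 = zInf :=
  (hy.hasLead 1 (one_pow _)).eq_of_aeval_eq hasLead_zInf one_pos one_ne_zero hF
    (hy.aeval_eq 1 (one_pow _))

lemma index_eq_of_eq (hy : IsBranchSystem F y) {ζ ξ : ℂ} (hζ : ζ ^ F.natDegree = 1)
    (hξ : ξ ^ F.natDegree = 1) (h : y ζ = y ξ) : ζ = ξ :=
  (hy.hasLead ζ hζ).congr_lead (h ▸ hy.hasLead ξ hξ)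

/-- A right composition factor `W` cannot distinguish two branches whose indices have the same
`deg W`-th power: both values solve `P(x) = F(z)` and they have the same leading term. -/
lemma aeval_eq_of_pow_eq (hy : IsBranchSystem F y) (h : P.comp W = F) (hP : 0 < P.natDegree)
    (hW : 0 < W.natDegree) {ζ ξ : ℂ} (hζ : ζ ^ F.natDegree = 1) (hξ : ξ ^ F.natDegree = 1)
    (hpow : ζ ^ W.natDegree = ξ ^ W.natDegree) : aeval (y ζ) W = aeval (y ξ) W := by
  have h1 := (hy.hasLead ζ hζ).aeval one_pos W
  have h2 := (hy.hasLead ξ hξ).aeval one_pos W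
  rw [hpow] at h1
  have hW0 : W ≠ 0 := by rintro rfl; simp at hW
  have hξ0 : ξ ≠ 0 := by
    rintro rfl
    rw [← h, natDegree_comp, zero_pow (Nat.mul_pos hP hW).ne'] at hξ
    exact zero_ne_one hξ
  refine h1.eq_of_aeval_eq h2 (by simpa using hW)
    (mul_ne_zero (leadingCoeff_ne_zero.mpr hW0) (pow_ne_zero _ hξ0)) hP ?_
  rw [← aeval_comp, ← aeval_comp, h, hy.aeval_eq ζ hζ, hy.aeval_eq ξ hξ]

/-- The roots of `W(X) = W(y ξ)` are the branches `y (ξ η)` with `η ^ deg W = 1`. -/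
lemma sub_C_eq_prod (hy : IsBranchSystem F y) (h : P.comp W = F) (hP : 0 < P.natDegree)
    (hW : 0 < W.natDegree) {ξ : ℂ} (hξ : ξ ^ F.natDegree = 1) :
    W.map (algebraMap ℂ (LaurentSeries ℂ)) - C (aeval (y ξ) W) =
      C (algebraMap ℂ (LaurentSeries ℂ) W.leadingCoeff) *
        ∏ η ∈ nthRootsFinset W.natDegree (1 : ℂ), (X - C (y (ξ * η))) := by
  have hW0 : W ≠ 0 := by rintro rfl; simp at hW
  have hN : F.natDegree = W.natDegree * P.natDegree := by rw [← h, natDegree_comp, mul_comm]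
  have hξ0 : ξ ≠ 0 := by
    rintro rfl
    rw [hN, zero_pow (Nat.mul_pos hW hP).ne'] at hξ
    exact zero_ne_one hξ
  have hη : ∀ η ∈ nthRootsFinset W.natDegree (1 : ℂ), (ξ * η) ^ F.natDegree = 1 := by
    intro η hη
    rw [mem_nthRootsFinset hW] at hη
    rw [mul_pow, hξ, hN, pow_mul, hη, one_pow, one_mul]
  have hl : algebraMap ℂ (LaurentSeries ℂ) W.leadingCoeff ≠ 0 := by simpa using hW0
  set f := W.map (algebraMap ℂ (LaurentSeries ℂ)) - C (aeval (y ξ) W) with hf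
  have hlt : (C (aeval (y ξ) W)).degree < (W.map (algebraMap ℂ (LaurentSeries ℂ))).degree := by
    refine lt_of_le_of_lt degree_C_le ?_
    rwa [← natDegree_pos_iff_degree_pos, natDegree_map]
  have hfl : f.leadingCoeff = algebraMap ℂ (LaurentSeries ℂ) W.leadingCoeff := by
    rw [hf, leadingCoeff_sub_of_degree_lt hlt, leadingCoeff_map]
  have hfd : f.natDegree = W.natDegree := by
    rw [hf, natDegree_sub_C, natDegree_map]
  have hcard := (Complex.isPrimitiveRoot_exp _ hW.ne').card_nthRootsFinset
  rw [← hfl]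
  refine eq_C_leadingCoeff_mul_prod_X_sub_C (fun a ha b hb hab => ?_) ?_ (fun η hη' => ?_)
    (by rw [hfd, hcard])
  · exact mul_left_cancel₀ hξ0 (hy.index_eq_of_eq (hη a ha) (hη b hb) hab)
  · intro h0; rw [h0, leadingCoeff_zero] at hfl; exact hl hfl.symm
  · rw [IsRoot.def, hf, eval_sub, eval_C, eval_map_algebraMap, sub_eq_zero]
    refine hy.aeval_eq_of_pow_eq h hP hW (hη η hη') hξ ?_
    rw [mem_nthRootsFinset hW] at hη'
    rw [mul_pow, hη', mul_one]

end IsBranchSystem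

/-! ### Invariant polynomials and traces -/

/-- A subalgebra of `k[X]` is generated by `D` as soon as it contains `D` and all degrees occurring
in it are multiples of `deg D`: subtract multiples of powers of `D` to lower the degree. -/
lemma exists_eq_comp_of_natDegree_dvd {k : Type*} [Field k] (S : Subalgebra k k[X]) {D : k[X]}
    (hD : 0 < D.natDegree) (hDS : D ∈ S) (hdvd : ∀ Q ∈ S, D.natDegree ∣ Q.natDegree) {Q : k[X]}
    (hQ : Q ∈ S) : ∃ T : k[X], Q = T.comp D := by
  induction hn : Q.natDegree using Nat.strong_induction_on generalizing Q with
  | _ n ih =>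
    subst hn
    rcases Nat.eq_zero_or_pos Q.natDegree with h0 | hpos
    · exact ⟨C (Q.coeff 0), by rw [C_comp]; exact eq_C_of_natDegree_eq_zero h0⟩
    have hQ0 : Q ≠ 0 := by rintro rfl; simp at hpos
    have hD0 : D.leadingCoeff ≠ 0 := by
      rw [leadingCoeff_ne_zero]; rintro rfl; simp at hD
    obtain ⟨m, hm⟩ := hdvd Q hQ
    set c := Q.leadingCoeff / D.leadingCoeff ^ m with hc
    have hc0 : c ≠ 0 := div_ne_zero (leadingCoeff_ne_zero.mpr hQ0) (pow_ne_zero _ hD0)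
    have hdeg : (C c * D ^ m).natDegree = Q.natDegree := by
      rw [natDegree_C_mul hc0, natDegree_pow, hm, mul_comm]
    have hlt : (Q - C c * D ^ m).natDegree < Q.natDegree := by
      rcases eq_or_ne (Q - C c * D ^ m) 0 with h0 | h0
      · rwa [h0, natDegree_zero]
      refine natDegree_lt_natDegree h0 (degree_sub_lt_left ?_ hQ0 ?_)
      · rw [degree_eq_natDegree hQ0, degree_eq_natDegree, hdeg]
        intro h; rw [h, natDegree_zero] at hdeg; omega
      · rw [leadingCoeff_mul, leadingCoeff_C, leadingCoeff_pow, hc,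
          div_mul_cancel₀ _ (pow_ne_zero _ hD0)]
    have hmem : Q - C c * D ^ m ∈ S :=
      S.sub_mem hQ (S.mul_mem (S.algebraMap_mem c) (S.pow_mem hDS m))
    obtain ⟨T, hT⟩ := ih _ hlt hmem rfl
    exact ⟨T + C c * X ^ m, by rw [add_comp, ← hT, mul_comp, C_comp, X_pow_comp, sub_add_cancel]⟩

/-- If a polynomial of degree `d` is invariant under the branches indexed by the `d`-th roots of
unity, then it generates the algebra of all polynomials invariant under them. -/
lemma exists_eq_comp_of_aeval_branch_eq {D : ℂ[X]} (hD : 0 < D.natDegree)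
    {y : ℂ → LaurentSeries ℂ} (hy : ∀ ζ, ζ ^ D.natDegree = 1 → HasLead (y ζ) 1 ζ)
    (hDy : ∀ ζ, ζ ^ D.natDegree = 1 → aeval (y ζ) D = aeval zInf D) {Q : ℂ[X]}
    (hQ : ∀ ζ, ζ ^ D.natDegree = 1 → aeval (y ζ) Q = aeval zInf Q) : ∃ T : ℂ[X], Q = T.comp D := by
  have hprim := Complex.isPrimitiveRoot_exp _ hD.ne'
  set ζ := Complex.exp (2 * Real.pi * Complex.I / D.natDegree)
  refine exists_eq_comp_of_natDegree_dvd (AlgHom.equalizer (aeval (y ζ)) (aeval zInf)) hD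
    (hDy ζ hprim.pow_eq_one) (fun R hR => ?_) (hQ ζ hprim.pow_eq_one)
  rcases eq_or_ne R 0 with rfl | hR0
  · simp
  have h1 := (hy ζ hprim.pow_eq_one).aeval one_pos R
  rw [show aeval (y ζ) R = aeval zInf R from hR] at h1
  have h2 := h1.congr_lead (hasLead_zInf.aeval one_pos R)
  rw [one_pow] at h2
  exact hprim.dvd_of_pow_eq_one _ (mul_left_cancel₀ (leadingCoeff_ne_zero.mpr hR0) h2)

/-- The trace of `Q` down to `k[D]`: the sum of `Q` over the roots of `D(X) = t` is a symmetric
function of these roots, hence a polynomial in `t`, and this polynomial does not depend on `t`. -/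
lemma exists_sum_aeval_eq {k L : Type*} [Field k] [Field L] [Algebra k L] {D : k[X]}
    (hD : D ≠ 0) (Q : k[X]) {σ : Type*} [Fintype σ] (hσ : Fintype.card σ = D.natDegree) :
    ∃ G : k[X], ∀ (y : σ → L) (t : L),
      D.map (algebraMap k L) - C t = C (algebraMap k L D.leadingCoeff) * ∏ i, (X - C (y i)) →
      ∑ i, aeval (y i) Q = aeval t G := by
  classical
  have hsymm : (∑ i : σ, aeval (MvPolynomial.X i : MvPolynomial σ k) Q).IsSymmetric := by
    intro e
    rw [map_sum]
    simp_rw [← Polynomial.aeval_algHom_apply, MvPolynomial.rename_X]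
    exact Equiv.sum_comp e fun i => aeval (MvPolynomial.X i : MvPolynomial σ k) Q
  obtain ⟨q, hq⟩ := MvPolynomial.esymmAlgHom_surjective (σ := σ) (R := k) hσ.le ⟨_, hsymm⟩
  have hq' := congrArg Subtype.val hq
  rw [MvPolynomial.esymmAlgHom_apply] at hq'
  -- `q` expresses the sum through elementary symmetric functions; substitute for these the
  -- normalized coefficients of `D - t`, with `t` replaced by the variable `X`.
  refine ⟨MvPolynomial.aeval (fun i : Fin D.natDegree =>
    (-1) ^ (i.1 + 1) * (C D.leadingCoeff⁻¹ *
      (C (D.coeff (D.natDegree - (i.1 + 1))) -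
        if D.natDegree - (i.1 + 1) = 0 then X else 0))) q, fun y t hyt => ?_⟩
  have h1 := congrArg (MvPolynomial.aeval y) hq'
  simp only [map_sum, ← Polynomial.aeval_algHom_apply, MvPolynomial.aeval_X] at h1
  rw [← h1]
  have h2 : ∀ f : MvPolynomial σ k →ₐ[k] L, ∀ g : k[X] →ₐ[k] L, ∀ u : Fin D.natDegree → _,
      ∀ v : Fin D.natDegree → _, (∀ i, f (u i) = g (v i)) →
      f (MvPolynomial.aeval u q) = g (MvPolynomial.aeval v q) := by
    intro f g u v huv
    rw [MvPolynomial.comp_aeval_apply, MvPolynomial.comp_aeval_apply]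
    simp_rw [huv]
  refine h2 _ _ _ _ fun i => ?_
  have hl : algebraMap k L D.leadingCoeff ≠ 0 := by simpa using hD
  have hcard : Multiset.card (Finset.univ.val.map y) = D.natDegree := by simpa using hσ
  have h3 := (Finset.univ.val.map y).prod_X_sub_C_coeff
    (k := D.natDegree - (i.1 + 1)) (by rw [hcard]; omega)
  rw [hcard, Nat.sub_sub_self (show i.1 + 1 ≤ _ from i.2), Multiset.map_map] at h3
  have h4 := congrArg (fun p => p.coeff (D.natDegree - (i.1 + 1))) hyt
  simp only [coeff_sub, coeff_map, coeff_C_mul, coeff_C] at h4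
  change _ = _ * (Multiset.map ((fun t => X - C t) ∘ y) Finset.univ.val).prod.coeff _ at h4
  rw [h3] at h4
  rw [MvPolynomial.aeval_esymm_eq_multiset_esymm]
  have h5 : ((-1 : L) ^ (i.1 + 1)) * (-1) ^ (i.1 + 1) = 1 := by
    rw [← mul_pow]; simp
  have h7 : aeval t (if D.natDegree - (i.1 + 1) = 0 then (X : k[X]) else 0) =
      if D.natDegree - (i.1 + 1) = 0 then t else 0 := by split_ifs <;> simp
  simp only [map_mul, map_pow, map_neg, map_one, map_sub, aeval_C, map_inv₀, h7]
  have h6 := mul_inv_cancel₀ hl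
  rw [h4]
  linear_combination (-(Finset.univ.val.map y).esymm (i.1 + 1)) *
    (h5 * (algebraMap k L D.leadingCoeff * (algebraMap k L D.leadingCoeff)⁻¹) + h6)

/-! ### Common left factors of two decompositions -/

lemma comp_right_cancel {k : Type*} [Field k] {P Q W : k[X]} (hW : 0 < W.natDegree)
    (h : P.comp W = Q.comp W) : P = Q := by
  have h1 : (P - Q).comp W = 0 := by rw [sub_comp, h, sub_self]
  rcases comp_eq_zero_iff.mp h1 with h2 | h2
  · exact sub_eq_zero.mp h2
  · rw [h2.2, natDegree_C] at hW
    exact absurd hW (lt_irrefl 0)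

lemma gcd_eq_of_mul_lcm_eq {p₁ p₂ w₁ w₂ u : ℕ} (hw₁ : 0 < w₁) (hw₂ : 0 < w₂)
    (h₁ : u * w₁.lcm w₂ = p₁ * w₁) (h₂ : u * w₁.lcm w₂ = p₂ * w₂) : u = p₁.gcd p₂ := by
  obtain ⟨q₁, hq₁⟩ := Nat.dvd_lcm_left w₁ w₂
  obtain ⟨q₂, hq₂⟩ := Nat.dvd_lcm_right w₁ w₂
  have hl := Nat.lcm_pos hw₁ hw₂
  have e₁ : p₁ = u * q₁ := by
    apply Nat.eq_of_mul_eq_mul_right hw₁; rw [← h₁, hq₁]; ring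
  have e₂ : p₂ = u * q₂ := by
    apply Nat.eq_of_mul_eq_mul_right hw₂; rw [← h₂, hq₂]; ring
  obtain ⟨a, ha⟩ := Nat.gcd_dvd_left q₁ q₂
  obtain ⟨b, hb⟩ := Nat.gcd_dvd_right q₁ q₂
  set g := q₁.gcd q₂
  have hg : 0 < g := by
    rcases Nat.eq_zero_or_pos g with h | h
    · rw [h, zero_mul] at ha; rw [ha] at hq₁; omega
    · exact h
  have hab : w₁ * a = w₂ * b := by
    apply Nat.eq_of_mul_eq_mul_left hg
    calc g * (w₁ * a) = w₁ * (g * a) := by ring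
      _ = w₂ * (g * b) := by rw [← ha, ← hb, ← hq₁, ← hq₂]
      _ = g * (w₂ * b) := by ring
  have hdvd : w₁.lcm w₂ ∣ w₁ * a := Nat.lcm_dvd (Dvd.intro _ rfl) (hab ▸ Dvd.intro _ rfl)
  have hle : w₁.lcm w₂ ≤ w₁ * a := Nat.le_of_dvd (by
    rcases Nat.eq_zero_or_pos a with h | h
    · rw [h, mul_zero] at ha; rw [ha] at hq₁; omega
    · positivity) hdvd
  have hg1 : g = 1 := by
    have : w₁.lcm w₂ = g * (w₁ * a) := by rw [hq₁, ha]; ring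
    nlinarith
  rw [e₁, e₂, Nat.gcd_mul_left, show q₁.gcd q₂ = 1 from hg1, mul_one]

lemma ne_zero_of_natDegree_pos {k : Type*} [Field k] {P : k[X]} (h : 0 < P.natDegree) : P ≠ 0 := by
  rintro rfl
  simp at h

/-- The polynomial of degree `lcm (deg W₁) (deg W₂)` in `ℂ[W₁] ∩ ℂ[W₂]` is the trace of a power of
`W₁` down to `ℂ[W₂]`. It lies in `ℂ[W₁]` because its value `∑ η, W₁(y (ξ η)) ^ j` at the branch
`y ξ` does not change when `ξ ^ deg W₁ = 1`. -/
lemma exists_comp_eq_natDegree_lcm {P₁ W₁ P₂ W₂ : ℂ[X]} (hP₁ : 0 < P₁.natDegree)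
    (hW₁ : 0 < W₁.natDegree) (hP₂ : 0 < P₂.natDegree) (hW₂ : 0 < W₂.natDegree)
    (h : P₁.comp W₁ = P₂.comp W₂) :
    ∃ Q₁ Q₂ : ℂ[X], Q₁.comp W₁ = Q₂.comp W₂ ∧
      (Q₁.comp W₁).natDegree = W₁.natDegree.lcm W₂.natDegree := by
  classical
  have hF : 0 < (P₂.comp W₂).natDegree := by rw [natDegree_comp]; positivity
  have hN₁ : (P₂.comp W₂).natDegree = W₁.natDegree * P₁.natDegree := by
    rw [← h, natDegree_comp, mul_comm]
  have hN₂ : (P₂.comp W₂).natDegree = W₂.natDegree * P₂.natDegree := by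
    rw [natDegree_comp, mul_comm]
  obtain ⟨y, hy⟩ := exists_isBranchSystem hF
  set s := nthRootsFinset W₂.natDegree (1 : ℂ)
  have hcard : s.card = W₂.natDegree :=
    (Complex.isPrimitiveRoot_exp _ hW₂.ne').card_nthRootsFinset
  have hmem : ∀ η ∈ s, η ^ W₂.natDegree = 1 := fun η hη => (mem_nthRootsFinset hW₂ 1).mp hη
  have hsN : ∀ η ∈ s, η ^ (P₂.comp W₂).natDegree = 1 := fun η hη => by
    rw [hN₂, pow_mul, hmem η hη, one_pow]
  -- The power `W₁ ^ j` has degree `lcm`, a multiple of `deg W₂`, so its values at the branches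
  -- `y η` all have the same leading term and these do not cancel in the sum.
  obtain ⟨j, hj⟩ := Nat.dvd_lcm_left W₁.natDegree W₂.natDegree
  obtain ⟨Q₂, hQ₂⟩ := exists_sum_aeval_eq (L := LaurentSeries ℂ) (ne_zero_of_natDegree_pos hW₂)
    (W₁ ^ j) (σ := s) (by rw [Fintype.card_coe, hcard])
  have key : ∀ ξ, ξ ^ (P₂.comp W₂).natDegree = 1 →
      aeval (y ξ) (Q₂.comp W₂) = ∑ η ∈ s, aeval (y (ξ * η)) W₁ ^ j := by
    intro ξ hξ
    rw [aeval_comp, ← hQ₂ (fun η => y (ξ * η)) (aeval (y ξ) W₂), ← Finset.sum_coe_sort s]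
    · simp
    · rw [hy.sub_C_eq_prod rfl hP₂ hW₂ hξ, ← Finset.prod_coe_sort s]
  have hz := hy.one_eq hF
  have hinv : ∀ ξ, ξ ^ W₁.natDegree = 1 →
      aeval (y ξ) (Q₂.comp W₂) = aeval zInf (Q₂.comp W₂) := by
    intro ξ hξ
    have hξN : ξ ^ (P₂.comp W₂).natDegree = 1 := by rw [hN₁, pow_mul, hξ, one_pow]
    rw [key ξ hξN, ← hz, key 1 (one_pow _)]
    refine Finset.sum_congr rfl fun η hη => ?_
    rw [hy.aeval_eq_of_pow_eq h hP₁ hW₁ (ζ := ξ * η) (ξ := 1 * η)]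
    · rw [mul_pow, hξN, hsN η hη, one_mul]
    · rw [one_mul, hsN η hη]
    · rw [mul_pow, hξ, one_mul, one_mul]
  have hinv₁ : ∀ ξ, ξ ^ W₁.natDegree = 1 → aeval (y ξ) W₁ = aeval zInf W₁ := by
    intro ξ hξ
    rw [← hz]
    exact hy.aeval_eq_of_pow_eq h hP₁ hW₁ (by rw [hN₁, pow_mul, hξ, one_pow]) (one_pow _)
      (by rw [hξ, one_pow])
  obtain ⟨Q₁, hQ₁⟩ := exists_eq_comp_of_aeval_branch_eq hW₁
    (fun ζ hζ => hy.hasLead ζ (by rw [hN₁, pow_mul, hζ, one_pow])) hinv₁ hinv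
  refine ⟨Q₁, Q₂, hQ₁.symm, ?_⟩
  rw [← hQ₁]
  have hlead : HasLead (aeval zInf (Q₂.comp W₂)) (W₁.natDegree.lcm W₂.natDegree)
      (∑ η ∈ s, W₁.leadingCoeff ^ j) := by
    rw [← hz, key 1 (one_pow _)]
    refine HasLead.sum s fun η hη => ?_
    have h1 := (hy.hasLead (1 * η) (by rw [one_mul, hsN η hη])).aeval one_pos (W₁ ^ j)
    obtain ⟨i, hi⟩ := Nat.dvd_lcm_right W₁.natDegree W₂.natDegree
    have hdeg : (W₁ ^ j).natDegree = W₁.natDegree.lcm W₂.natDegree := by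
      rw [natDegree_pow, hj, mul_comm]
    rw [hdeg, map_pow, leadingCoeff_pow, one_mul, one_mul] at h1
    nth_rewrite 2 [hi] at h1
    rw [pow_mul, hmem η hη, one_pow, mul_one] at h1
    rw [one_mul]
    exact h1
  have hG0 : Q₂.comp W₂ ≠ 0 := by
    intro h0
    rw [h0, map_zero] at hlead
    have := hlead.congr_lead (d := 0) ⟨0, by simp⟩
    simp [hcard, hW₂.ne', ne_zero_of_natDegree_pos hW₁] at this
  have h2 := (hasLead_zInf.aeval one_pos (Q₂.comp W₂)).eq_of_ne_zero hlead
    (by simpa using hG0) (by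
      rw [Finset.sum_const, hcard, nsmul_eq_mul]
      exact mul_ne_zero (Nat.cast_ne_zero.mpr hW₂.ne')
        (pow_ne_zero _ (leadingCoeff_ne_zero.mpr (ne_zero_of_natDegree_pos hW₁))))
  rw [← h2.1, one_mul]

/-- The degrees in `ℂ[W₁] ∩ ℂ[W₂]` are common multiples of `deg W₁` and `deg W₂`, so this algebra
is `ℂ[G]` for its element `G` of degree `lcm (deg W₁) (deg W₂)`. -/
lemma exists_common_left_factor {P₁ W₁ P₂ W₂ : ℂ[X]} (hP₁ : 0 < P₁.natDegree)
    (hW₁ : 0 < W₁.natDegree) (hP₂ : 0 < P₂.natDegree) (hW₂ : 0 < W₂.natDegree)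
    (h : P₁.comp W₁ = P₂.comp W₂) :
    ∃ U Q₁ Q₂ : ℂ[X], U.natDegree = P₁.natDegree.gcd P₂.natDegree ∧ P₁ = U.comp Q₁ ∧
      P₂ = U.comp Q₂ ∧ Q₁.comp W₁ = Q₂.comp W₂ := by
  obtain ⟨Q₁, Q₂, hQ, hdeg⟩ := exists_comp_eq_natDegree_lcm hP₁ hW₁ hP₂ hW₂ h
  have hmem : ∀ Q W : ℂ[X], Q.comp W ∈ (aeval W : ℂ[X] →ₐ[ℂ] ℂ[X]).range := fun Q W => ⟨Q, rfl⟩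
  obtain ⟨U, hU⟩ := exists_eq_comp_of_natDegree_dvd
    ((aeval W₁ : ℂ[X] →ₐ[ℂ] ℂ[X]).range ⊓ (aeval W₂ : ℂ[X] →ₐ[ℂ] ℂ[X]).range)
    (D := Q₁.comp W₁) (by rw [hdeg]; exact Nat.lcm_pos hW₁ hW₂)
    ⟨hmem Q₁ W₁, hQ ▸ hmem Q₂ W₂⟩ (by
      rintro _ ⟨⟨R₁, rfl⟩, ⟨R₂, hR⟩⟩
      rw [hdeg]
      refine Nat.lcm_dvd ?_ ?_
      · change _ ∣ (R₁.comp W₁).natDegree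
        rw [natDegree_comp]; exact Dvd.intro_left _ rfl
      · rw [← hR]
        change _ ∣ (R₂.comp W₂).natDegree
        rw [natDegree_comp]; exact Dvd.intro_left _ rfl)
    (Q := P₁.comp W₁) ⟨hmem P₁ W₁, h ▸ hmem P₂ W₂⟩
  have hd := congrArg natDegree hU
  rw [natDegree_comp (p := U), hdeg, natDegree_comp] at hd
  have hd' := hd
  rw [← natDegree_comp, h, natDegree_comp] at hd'
  refine ⟨U, Q₁, Q₂, gcd_eq_of_mul_lcm_eq hW₁ hW₂ hd.symm hd'.symm, ?_, ?_, hQ⟩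
  · exact comp_right_cancel hW₁ (by rw [hU, comp_assoc])
  · exact comp_right_cancel hW₂ (by rw [← h, hU, comp_assoc, hQ])

/-! ### Common right factors of two decompositions -/

/-- The polynomial `W(X) - W(t)` in `X` over `ℂ[t]`, divided by the leading coefficient of `W` to
make it monic. -/
noncomputable def diffPoly (W : ℂ[X]) : ℂ[X][X] :=
  C (C W.leadingCoeff⁻¹) * (W.map C - C W)

lemma diffPoly_monic {W : ℂ[X]} (hW : 0 < W.natDegree) : (diffPoly W).Monic := by
  have hlt : (C W : ℂ[X][X]).degree < (W.map C).degree := by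
    refine lt_of_le_of_lt degree_C_le ?_
    rwa [← natDegree_pos_iff_degree_pos, natDegree_map]
  refine monic_C_mul_of_mul_leadingCoeff_eq_one ?_
  rw [leadingCoeff_sub_of_degree_lt hlt, leadingCoeff_map, ← C_mul,
    inv_mul_cancel₀ (leadingCoeff_ne_zero.mpr (ne_zero_of_natDegree_pos hW)), C_1]

lemma diffPoly_map {L : Type*} [Field L] [Algebra ℂ L] (W : ℂ[X]) (a : L) :
    (diffPoly W).map (aeval (R := ℂ) a).toRingHom =
      C (algebraMap ℂ L W.leadingCoeff⁻¹) * (W.map (algebraMap ℂ L) - C (aeval a W)) := by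
  have : (aeval (R := ℂ) a).toRingHom.comp C = algebraMap ℂ L := by
    ext; simp
  simp only [diffPoly, Polynomial.map_mul, Polynomial.map_sub, map_C, Polynomial.map_map, this]
  simp

lemma diffPoly_map_isRoot_iff {L : Type*} [Field L] [Algebra ℂ L] {W : ℂ[X]}
    (hW : 0 < W.natDegree) (a b : L) :
    ((diffPoly W).map (aeval (R := ℂ) a).toRingHom).IsRoot b ↔ aeval b W = aeval a W := by
  rw [diffPoly_map, IsRoot.def, eval_mul, eval_C, eval_sub, eval_C, eval_map_algebraMap,
    mul_eq_zero, sub_eq_zero, or_iff_right]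
  simpa using ne_zero_of_natDegree_pos hW

lemma natDegree_le_card_filter_isRoot_of_dvd_prod {K ι : Type*} [Field K] {p : K[X]}
    {s : Finset ι} {u : ι → K} (hu : Set.InjOn u s) {c : K} (hc : c ≠ 0)
    (hp : p ∣ C c * ∏ i ∈ s, (X - C (u i))) [DecidablePred fun i => p.IsRoot (u i)] :
    p.natDegree ≤ (s.filter fun i => p.IsRoot (u i)).card := by
  classical
  have hne : C c * ∏ i ∈ s, (X - C (u i)) ≠ 0 :=
    mul_ne_zero (C_ne_zero.mpr hc) (monic_prod_of_monic s _ fun i _ => monic_X_sub_C (u i)).ne_zero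
  have hsplit : (C c * ∏ i ∈ s, (X - C (u i))).Splits :=
    (Splits.C c).mul (Splits.prod fun i _ => Splits.X_sub_C (u i))
  have hroots : (C c * ∏ i ∈ s, (X - C (u i))).roots = (s.image u).val := by
    rw [roots_C_mul _ hc, ← roots_prod_X_sub_C (s.image u), Finset.prod_image hu]
  have hle := roots.le_of_dvd hne hp
  rw [hroots] at hle
  rw [(hsplit.of_dvd hne hp).natDegree_eq_card_roots,
    ← Multiset.toFinset_card_of_nodup (Multiset.nodup_of_le hle (s.image u).nodup)]
  refine (Finset.card_le_card fun a ha => ?_).trans (Finset.card_image_le (f := u))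
  rw [Multiset.mem_toFinset] at ha
  obtain ⟨i, hi, rfl⟩ := Finset.mem_image.mp (Multiset.mem_of_le hle ha)
  exact Finset.mem_image_of_mem u (Finset.mem_filter.mpr ⟨hi, isRoot_of_mem_roots ha⟩)

/-- Over an integrally closed domain, the monic greatest common divisor over the fraction field of
a monic `f` and any `g` has coefficients in the domain. It is characterized here by its roots under
each embedding of the domain into a field. -/
lemma exists_monic_dvd_isRoot_iff {R : Type*} [CommRing R] [IsDomain R] [IsIntegrallyClosed R]
    {f g : R[X]} (hf : f.Monic) :
    ∃ h : R[X], h.Monic ∧ h ∣ f ∧ ∀ {L : Type} [Field L] (φ : R →+* L),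
      Function.Injective φ → ∀ a, (h.map φ).IsRoot a ↔ (f.map φ).IsRoot a ∧ (g.map φ).IsRoot a := by
  classical
  let K := FractionRing R
  set d := EuclideanDomain.gcd (f.map (algebraMap R K)) (g.map (algebraMap R K)) with hd
  have hd0 : d ≠ 0 :=
    ne_zero_of_dvd_ne_zero (hf.map _).ne_zero (EuclideanDomain.gcd_dvd_left _ _)
  have hl : d.leadingCoeff ≠ 0 := leadingCoeff_ne_zero.mpr hd0
  obtain ⟨h, hh⟩ := IsIntegrallyClosed.eq_map_mul_C_of_dvd K hf
    (g := d) (EuclideanDomain.gcd_dvd_left _ _)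
  have hmon : h.Monic := by
    refine monic_of_injective (IsFractionRing.injective R K) ?_
    have := congrArg leadingCoeff hh
    rw [leadingCoeff_mul, leadingCoeff_C] at this
    exact mul_right_cancel₀ hl (by rw [this, one_mul])
  refine ⟨h, hmon, ?_, fun {L} _ φ hφ a => ?_⟩
  · rw [← map_dvd_map _ (IsFractionRing.injective R K) hmon]
    exact (Dvd.intro _ hh).trans (EuclideanDomain.gcd_dvd_left _ _)
  · let ψ : K →+* L := IsFractionRing.lift hφ
    have hψ : ψ.comp (algebraMap R K) = φ := by
      ext x; exact IsFractionRing.lift_algebraMap hφ x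
    have h1 := root_gcd_iff_root_left_right (ϕ := ψ) (f := f.map (algebraMap R K))
      (g := g.map (algebraMap R K)) (α := a)
    rw [← hd, ← hh, eval₂_mul, eval₂_C, eval₂_map, eval₂_map, eval₂_map, hψ, mul_eq_zero,
      or_iff_left ((map_ne_zero ψ).mpr hl)] at h1
    simpa only [IsRoot.def, eval_map] using h1

/-- The common factor is the constant coefficient of the greatest common divisor of `W₁(X) - W₁(z)`
and `W₂(X) - W₂(z)`, which is the product of the branches `-y η` with
`η ^ gcd (deg W₁) (deg W₂) = 1`. It is invariant under `z ↦ y ξ` for the same `ξ`, as this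
substitution changes neither `W₁(z)` nor `W₂(z)`. -/
lemma exists_common_right_factor {P₁ W₁ P₂ W₂ : ℂ[X]} (hP₁ : 0 < P₁.natDegree)
    (hW₁ : 0 < W₁.natDegree) (hP₂ : 0 < P₂.natDegree) (hW₂ : 0 < W₂.natDegree)
    (h : P₁.comp W₁ = P₂.comp W₂) :
    ∃ V T₁ T₂ : ℂ[X], V.natDegree = W₁.natDegree.gcd W₂.natDegree ∧ W₁ = T₁.comp V ∧
      W₂ = T₂.comp V := by
  classical
  have hF : 0 < (P₂.comp W₂).natDegree := by rw [natDegree_comp]; positivity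
  have hN₁ : (P₂.comp W₂).natDegree = W₁.natDegree * P₁.natDegree := by
    rw [← h, natDegree_comp, mul_comm]
  have hN₂ : (P₂.comp W₂).natDegree = W₂.natDegree * P₂.natDegree := by
    rw [natDegree_comp, mul_comm]
  obtain ⟨y, hy⟩ := exists_isBranchSystem hF
  have hz := hy.one_eq hF
  have hg : 0 < W₁.natDegree.gcd W₂.natDegree := Nat.gcd_pos_of_pos_left _ hW₁
  have hgN : ∀ {ζ : ℂ}, ζ ^ W₁.natDegree.gcd W₂.natDegree = 1 →
      ζ ^ W₁.natDegree = 1 ∧ ζ ^ W₂.natDegree = 1 ∧ ζ ^ (P₂.comp W₂).natDegree = 1 := by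
    intro ζ hζ
    have h1 : ζ ^ W₁.natDegree = 1 := by
      obtain ⟨a, ha⟩ := Nat.gcd_dvd_left W₁.natDegree W₂.natDegree
      rw [ha, pow_mul, hζ, one_pow]
    have h2 : ζ ^ W₂.natDegree = 1 := by
      obtain ⟨a, ha⟩ := Nat.gcd_dvd_right W₁.natDegree W₂.natDegree
      rw [ha, pow_mul, hζ, one_pow]
    exact ⟨h1, h2, by rw [hN₁, pow_mul, h1, one_pow]⟩
  have hinv : ∀ ζ : ℂ, ζ ^ W₁.natDegree.gcd W₂.natDegree = 1 →
      aeval (y ζ) W₁ = aeval zInf W₁ ∧ aeval (y ζ) W₂ = aeval zInf W₂ := by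
    intro ζ hζ
    obtain ⟨h1, h2, h3⟩ := hgN hζ
    rw [← hz]
    exact ⟨hy.aeval_eq_of_pow_eq h hP₁ hW₁ h3 (one_pow _) (by rw [h1, one_pow]),
      hy.aeval_eq_of_pow_eq rfl hP₂ hW₂ h3 (one_pow _) (by rw [h2, one_pow])⟩
  obtain ⟨f, hfmon, hfdvd, hfroot⟩ :=
    exists_monic_dvd_isRoot_iff (f := diffPoly W₁) (g := diffPoly W₂) (diffPoly_monic hW₁)
  set s := nthRootsFinset (W₁.natDegree.gcd W₂.natDegree) (1 : ℂ)
  have hcard : s.card = W₁.natDegree.gcd W₂.natDegree :=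
    (Complex.isPrimitiveRoot_exp _ hg.ne').card_nthRootsFinset
  have hmem : ∀ η, η ∈ s ↔ η ^ W₁.natDegree.gcd W₂.natDegree = 1 :=
    fun η => mem_nthRootsFinset hg 1
  have hW₁prod := hy.sub_C_eq_prod h hP₁ hW₁ (one_pow _)
  have hfac : ∀ ξ, ξ ^ W₁.natDegree.gcd W₂.natDegree = 1 →
      f.map (aeval (R := ℂ) (y ξ)).toRingHom = ∏ η ∈ s, (X - C (y η)) := by
    intro ξ hξ
    have hξ1 : HasLead (y ξ) 1 ξ := hy.hasLead ξ (hgN hξ).2.2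
    have hξ0 : ξ ≠ 0 := by rintro rfl; rw [zero_pow hg.ne'] at hξ; exact zero_ne_one hξ
    have hmon := hfmon.map (aeval (R := ℂ) (y ξ)).toRingHom
    have hroots : ∀ a, (f.map (aeval (R := ℂ) (y ξ)).toRingHom).IsRoot a ↔
        aeval a W₁ = aeval zInf W₁ ∧ aeval a W₂ = aeval zInf W₂ := by
      intro a
      rw [hfroot _ (hξ1.aeval_injective one_pos hξ0), diffPoly_map_isRoot_iff hW₁,
        diffPoly_map_isRoot_iff hW₂, (hinv ξ hξ).1, (hinv ξ hξ).2]
    have hle : (f.map (aeval (R := ℂ) (y ξ)).toRingHom).natDegree ≤ s.card := by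
      have hdvd : f.map (aeval (R := ℂ) (y ξ)).toRingHom ∣
          C (algebraMap ℂ (LaurentSeries ℂ) (W₁.leadingCoeff⁻¹ * W₁.leadingCoeff)) *
            ∏ η ∈ nthRootsFinset W₁.natDegree (1 : ℂ), (X - C (y (1 * η))) := by
        have := Polynomial.map_dvd (aeval (R := ℂ) (y ξ)).toRingHom hfdvd
        rwa [diffPoly_map, (hinv ξ hξ).1, ← hz, hW₁prod, ← mul_assoc, ← C_mul, ← map_mul] at this
      refine (natDegree_le_card_filter_isRoot_of_dvd_prod (fun a ha b hb hab => ?_) ?_ hdvd).trans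
        (Finset.card_le_card fun η hη => ?_)
      · have hN : ∀ η ∈ nthRootsFinset W₁.natDegree (1 : ℂ),
            (1 * η) ^ (P₂.comp W₂).natDegree = 1 := fun η hη => by
          rw [one_mul, hN₁, pow_mul, (mem_nthRootsFinset hW₁ 1).mp hη, one_pow]
        simpa using hy.index_eq_of_eq (hN a ha) (hN b hb) hab
      · simpa using ne_zero_of_natDegree_pos hW₁
      · rw [Finset.mem_filter, mem_nthRootsFinset hW₁, one_mul, hroots] at hη
        obtain ⟨hη₁, -, hη₂⟩ := hη
        have hηN : η ^ (P₂.comp W₂).natDegree = 1 := by rw [hN₁, pow_mul, hη₁, one_pow]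
        -- comparing the leading coefficients of the two sides of `hη₂`
        have h1 := (hy.hasLead η hηN).aeval one_pos W₂
        rw [hη₂] at h1
        have h2 := h1.congr_lead (hasLead_zInf.aeval one_pos W₂)
        rw [one_pow] at h2
        rw [hmem]
        exact pow_gcd_eq_one.mpr ⟨hη₁, mul_left_cancel₀
          (leadingCoeff_ne_zero.mpr (ne_zero_of_natDegree_pos hW₂)) h2⟩
    have hinj : Set.InjOn y s := fun a ha b hb hab =>
      hy.index_eq_of_eq (hgN ((hmem a).mp ha)).2.2 (hgN ((hmem b).mp hb)).2.2 hab
    have := eq_C_leadingCoeff_mul_prod_X_sub_C hinj hmon.ne_zero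
      (fun η hη => (hroots _).mpr (hinv η ((hmem η).mp hη))) hle
    rwa [hmon.leadingCoeff, C_1, one_mul] at this
  have hval : ∀ ξ, ξ ^ W₁.natDegree.gcd W₂.natDegree = 1 →
      aeval (y ξ) (f.coeff 0) = ∏ η ∈ s, (-y η) := by
    intro ξ hξ
    have h1 := congrArg (eval 0) (hfac ξ hξ)
    rw [← coeff_zero_eq_eval_zero, coeff_map, eval_prod] at h1
    simpa using h1
  have hVinv : ∀ ξ, ξ ^ W₁.natDegree.gcd W₂.natDegree = 1 →
      aeval (y ξ) (f.coeff 0) = aeval zInf (f.coeff 0) := fun ξ hξ => by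
    rw [hval ξ hξ, ← hz, hval 1 (one_pow _)]
  have hlead : HasLead (aeval zInf (f.coeff 0)) (W₁.natDegree.gcd W₂.natDegree)
      (∏ η ∈ s, (-η)) := by
    rw [← hz, hval 1 (one_pow _), ← hcard]
    exact HasLead.prod s fun η hη => (hy.hasLead η (hgN ((hmem η).mp hη)).2.2).neg
  have hne : ∏ η ∈ s, (-η) ≠ 0 := by
    refine Finset.prod_ne_zero_iff.mpr fun η hη => neg_ne_zero.mpr ?_
    rintro rfl
    rw [hmem, zero_pow hg.ne'] at hη
    exact zero_ne_one hη
  have hV0 : f.coeff 0 ≠ 0 := by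
    intro h0
    rw [h0, map_zero] at hlead
    exact hne (hlead.congr_lead (d := 0) ⟨0, by simp⟩)
  have hdeg : (f.coeff 0).natDegree = W₁.natDegree.gcd W₂.natDegree := by
    have := (hasLead_zInf.aeval one_pos (f.coeff 0)).eq_of_ne_zero hlead (by simpa using hV0) hne
    rw [← this.1, one_mul]
  have hdesc : ∀ W : ℂ[X], (∀ ζ : ℂ, ζ ^ W₁.natDegree.gcd W₂.natDegree = 1 →
      aeval (y ζ) W = aeval zInf W) → ∃ T : ℂ[X], W = T.comp (f.coeff 0) := fun W hW =>
    exists_eq_comp_of_aeval_branch_eq (hdeg ▸ hg)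
      (by rw [hdeg]; exact fun ζ hζ => hy.hasLead ζ (hgN hζ).2.2) (by rw [hdeg]; exact hVinv)
      (by rw [hdeg]; exact hW)
  obtain ⟨T₁, hT₁⟩ := hdesc W₁ fun ζ hζ => (hinv ζ hζ).1
  obtain ⟨T₂, hT₂⟩ := hdesc W₂ fun ζ hζ => (hinv ζ hζ).2
  exact ⟨f.coeff 0, T₁, T₂, hdeg, hT₁, hT₂⟩

/-! ### Any number of decompositions -/

lemma gcd_univ_fin_succ {r : ℕ} (f : Fin (r + 1) → ℕ) :
    Finset.univ.gcd f = (f 0).gcd (Finset.univ.gcd fun i : Fin r => f i.succ) := by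
  refine Nat.dvd_antisymm (Nat.dvd_gcd (Finset.gcd_dvd (Finset.mem_univ 0))
    (Finset.dvd_gcd fun i _ => Finset.gcd_dvd (Finset.mem_univ i.succ))) ?_
  exact Finset.dvd_gcd fun i _ => Fin.cases (Nat.gcd_dvd_left _ _)
    (fun i => (Nat.gcd_dvd_right _ _).trans (Finset.gcd_dvd (Finset.mem_univ i))) i

/-- The induction keeps track of a common value `G` of the `Q i ∘ W i`: this value would not be
determined by `U` and the `P i` alone. -/
lemma exists_common_left_factor_fin (r : ℕ) (P W : Fin (r + 1) → ℂ[X])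
    (hP : ∀ i, 0 < (P i).natDegree) (hW : ∀ i, 0 < (W i).natDegree)
    (h : ∀ i j, (P i).comp (W i) = (P j).comp (W j)) :
    ∃ (U G : ℂ[X]) (Q : Fin (r + 1) → ℂ[X]),
      U.natDegree = Finset.univ.gcd (fun i => (P i).natDegree) ∧
      (∀ i, P i = U.comp (Q i)) ∧ ∀ i, (Q i).comp (W i) = G := by
  induction r with
  | zero =>
    refine ⟨P 0, W 0, fun _ => X, by simp, fun i => ?_, fun i => ?_⟩
    · rw [Fin.fin_one_eq_zero i, comp_X]
    · rw [Fin.fin_one_eq_zero i, X_comp]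
  | succ r ih =>
    obtain ⟨U, G, Q, hU, hPQ, hG⟩ := ih (fun i => P i.succ) (fun i => W i.succ)
      (fun i => hP _) (fun i => hW _) fun i j => h _ _
    have hUG : U.comp G = (P 0).comp (W 0) := by
      rw [← hG 0, ← comp_assoc, ← hPQ, h]
    have hpos : 0 < U.natDegree * G.natDegree := by
      rw [← natDegree_comp, hUG, natDegree_comp]; exact Nat.mul_pos (hP 0) (hW 0)
    obtain ⟨U', A, B, hU', hA, hB, hAB⟩ := exists_common_left_factor
      (Nat.pos_of_mul_pos_right hpos) (Nat.pos_of_mul_pos_left hpos) (hP 0) (hW 0) hUG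
    refine ⟨U', A.comp G, Fin.cons B fun i => A.comp (Q i), ?_, ?_, ?_⟩
    · rw [hU', hU, Nat.gcd_comm]
      exact (gcd_univ_fin_succ fun i => (P i).natDegree).symm
    · exact Fin.cases hB fun i => by rw [Fin.cons_succ, ← comp_assoc, ← hA, hPQ]
    · exact Fin.cases hAB.symm fun i => by rw [Fin.cons_succ, comp_assoc, hG]

lemma exists_common_right_factor_fin (r : ℕ) (P W : Fin (r + 1) → ℂ[X])
    (hP : ∀ i, 0 < (P i).natDegree) (hW : ∀ i, 0 < (W i).natDegree)
    (h : ∀ i j, (P i).comp (W i) = (P j).comp (W j)) :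
    ∃ (V : ℂ[X]) (T : Fin (r + 1) → ℂ[X]),
      V.natDegree = Finset.univ.gcd (fun i => (W i).natDegree) ∧ ∀ i, W i = (T i).comp V := by
  induction r with
  | zero =>
    refine ⟨W 0, fun _ => X, by simp, fun i => ?_⟩
    rw [Fin.fin_one_eq_zero i, X_comp]
  | succ r ih =>
    obtain ⟨V, T, hV, hWT⟩ := ih (fun i => P i.succ) (fun i => W i.succ)
      (fun i => hP _) (fun i => hW _) fun i j => h _ _
    have hVF : ((P 1).comp (T 0)).comp V = (P 0).comp (W 0) := by
      rw [comp_assoc, ← hWT 0]; exact h 1 0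
    have hpos : 0 < ((P 1).comp (T 0)).natDegree * V.natDegree := by
      rw [← natDegree_comp, hVF, natDegree_comp]; exact Nat.mul_pos (hP 0) (hW 0)
    obtain ⟨V', A, B, hV', hA, hB⟩ := exists_common_right_factor
      (Nat.pos_of_mul_pos_right hpos) (Nat.pos_of_mul_pos_left hpos) (hP 0) (hW 0) hVF
    refine ⟨V', Fin.cons B fun i => (T i).comp A, ?_, ?_⟩
    · rw [hV', hV, Nat.gcd_comm]
      exact (gcd_univ_fin_succ fun i => (W i).natDegree).symm
    · exact Fin.cases hB fun i => by rw [Fin.cons_succ, comp_assoc, ← hA, hWT]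

theorem theorem3p1 (r : ℕ) (P W : Fin r → Polynomial ℂ)
    (hP : ∀ i, 0 < (P i).natDegree) (hW : ∀ i, 0 < (W i).natDegree)
    (h : ∀ i j, (P i).comp (W i) = (P j).comp (W j)) :
    ∃ (U V : Polynomial ℂ) (P' W' : Fin r → Polynomial ℂ),
      U.natDegree = Finset.univ.gcd (fun i => (P i).natDegree) ∧
      V.natDegree = Finset.univ.gcd (fun i => (W i).natDegree) ∧
      (∀ i, P i = U.comp (P' i)) ∧
      (∀ i, W i = (W' i).comp V) ∧
      (∀ i j, (P' i).comp (W' i) = (P' j).comp (W' j)) := by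
  cases r with
  -- the empty gcd is zero, the degree of a constant
  | zero => exact ⟨0, 0, P, W, by simp, by simp, fun i => i.elim0, fun i => i.elim0,
      fun i => i.elim0⟩
  | succ r =>
    obtain ⟨U, G, Q, hU, hPQ, hG⟩ := exists_common_left_factor_fin r P W hP hW h
    obtain ⟨V, T, hV, hWT⟩ := exists_common_right_factor_fin r P W hP hW h
    have hVpos : 0 < V.natDegree := by
      have h0 := hW 0
      rw [hWT 0, natDegree_comp] at h0
      exact Nat.pos_of_mul_pos_left h0
    refine ⟨U, V, Q, T, hU, hV, hPQ, hWT, fun i j => comp_right_cancel hVpos ?_⟩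
    rw [comp_assoc, comp_assoc, ← hWT, ← hWT, hG, hG]
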